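/- Let $V$ be a simple Euclidean Jordan algebra of rank $2$ with unit $e$, i.e. a finite-dimensional real commutative algebra with unit satisfying $x(x^2y)=x^2(xy)$, without nontrivial ideals, equipped with its trace inner product $\langle x,y\rangle=\operatorname{tr}(xy)$, which is positive definite and satisfies $\langle xy,z\rangle=\langle y,xz\rangle$ (here $\operatorname{tr}x$ is the sum of the eigenvalues of $x$; the rank is the maximal degree of the minimal polynomial of an element). A Jordan frame of $V$ is a pair $\{c_1,c_2\}$ of primitive idempotents with $c_1c_2=0$ and $c_1+c_2=e$; it is attached to $a\in V$ if $a=a_1c_1+a_2c_2$ for some $a_1,a_2\in\mathbb R$. Let $Q=\{x^2:x\in V\}$ be the cone of squares and let $P_D$ denote the metric projection onto a nonempty closed convex set $D$. A set $M\subset V$ is called lattice-like if $P_{x-Q}\,y\in M$ and $P_{x+Q}\,y\in M$ for all $x,y\in M$. Let $a\in V$ with $\|a\|=1$ and let $H=\{x\in V:\langle a,x\rangle=0\}$. Then: (1) $H$ is lattice-like if and only if there is a Jordan frame $\{c_1,c_2\}$ with $a=\frac{\sqrt2}{2}c_1-\frac{\sqrt2}{2}c_2$. Moreover, for every Jordan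 frame $\{c_1,c_2\}$ attached to $a$, with $a=a_1c_1+a_2c_2$, the hyperplane $H$ is lattice-like if and only if $(a_1,a_2)$ is $\left(\frac{\sqrt2}{2},-\frac{\sqrt2}{2}\right)$ or $\left(-\frac{\sqrt2}{2},\frac{\sqrt2}{2}\right)$. (2) If $H$ is lattice-like, then $H$ is a Jordan subalgebra of $V$, i.e. $xy\in H$ for all $x,y\in H$. -/

import Mathlib

open scoped Pointwise

noncomputable section

/-- A Euclidean Jordan algebra: a real inner product space (assumed finite-dimensional where it is
used) with a commutative bilinear product satisfying the Jordan identity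
`(x * y) * (x * x) = x * (y * (x * x))` (the Mathlib class `IsCommJordan`), a unit element `1`, and
an associative inner product: `⟪x * y, z⟫ = ⟪y, x * z⟫`. -/
class IsEuclideanJordanAlgebra (V : Type*) [NormedAddCommGroup V] [InnerProductSpace ℝ V]
    [CommMagma V] [One V] : Prop extends IsCommJordan V where
  one_mul' : ∀ x : V, 1 * x = x
  add_mul' : ∀ x y z : V, (x + y) * z = x * z + y * z
  smul_mul' : ∀ (t : ℝ) (x y : V), (t • x) * y = t • (x * y)
  inner_mul' : ∀ x y z : V, inner ℝ (x * y) z = inner ℝ y (x * z)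

section Definitions

variable {V : Type*} [NormedAddCommGroup V] [InnerProductSpace ℝ V] [CommMagma V] [One V]

/-- `S` is an ideal of the (commutative) algebra `V`. -/
def IsJordanIdeal (S : Submodule ℝ V) : Prop := ∀ x y : V, y ∈ S → x * y ∈ S

/-- `S` is a Jordan subalgebra: a linear subspace closed under the product. -/
def IsJordanSubalgebra (S : Submodule ℝ V) : Prop := ∀ x ∈ S, ∀ y ∈ S, x * y ∈ S

variable (V) in
/-- The algebra is simple: it is nonzero and has no nontrivial ideal. -/
def IsSimpleJordan : Prop :=
  Nontrivial V ∧ ∀ S : Submodule ℝ V, IsJordanIdeal S → S = ⊥ ∨ S = ⊤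

/-- The powers `x⁰ = 1`, `xⁿ⁺¹ = x * xⁿ`. -/
def jordanPow (x : V) : ℕ → V
  | 0 => 1
  | n + 1 => x * jordanPow x n

/-- The degree of the minimal polynomial of `x`: the least `k > 0` such that
`1, x, …, xᵏ` are linearly dependent. -/
def jordanDegree (x : V) : ℕ :=
  sInf {k : ℕ | 0 < k ∧ ¬ LinearIndependent ℝ (fun i : Fin (k + 1) => jordanPow x i)}

variable (V) in
/-- The rank of the algebra: the maximal degree of the minimal polynomial of an element. -/
def jordanRank : ℕ := ⨆ x : V, jordanDegree x

/-- A primitive idempotent: a nonzero idempotent that is not the sum of two nonzero idempotents. -/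
def IsPrimitiveIdempotent (c : V) : Prop :=
  c ≠ 0 ∧ c * c = c ∧
    ∀ d f : V, d * d = d → f * f = f → d ≠ 0 → f ≠ 0 → c ≠ d + f

/-- A Jordan frame: pairwise orthogonal primitive idempotents with sum `1`. -/
def IsJordanFrame {n : ℕ} (c : Fin n → V) : Prop :=
  (∀ i, IsPrimitiveIdempotent (c i)) ∧ (∀ i j, i ≠ j → c i * c j = 0) ∧ ∑ i, c i = 1

/-- `t` is the sum of the eigenvalues of `x`, i.e. of the coefficients in a spectral decomposition
`x = ∑ i, l i • c i` with respect to a Jordan frame `c`. -/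
def IsTraceOf (x : V) (t : ℝ) : Prop :=
  ∃ (c : Fin (jordanRank V) → V) (l : Fin (jordanRank V) → ℝ),
    IsJordanFrame c ∧ x = ∑ i, l i • c i ∧ t = ∑ i, l i

/-- The trace of `x`: the sum of its eigenvalues. In a Euclidean Jordan algebra every `x` has a
spectral decomposition, and the eigenvalues do not depend on it. -/
def jordanTrace (x : V) : ℝ := Classical.epsilon (IsTraceOf x)

variable (V) in
/-- The cone of squares. -/
def squareCone : Set V := {q | ∃ x : V, q = x * x}

end Definitions

section Lattice

variable {V : Type*} [NormedAddCommGroup V] [InnerProductSpace ℝ V]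

/-- `p` is a nearest point of `x` in `D`. -/
def IsNearestPoint (D : Set V) (x p : V) : Prop := p ∈ D ∧ ‖x - p‖ = ⨅ y : D, ‖x - y‖

/-- The metric projection `P_D`: it sends `x` to its nearest point in `D` (which exists and is
unique if `D` is nonempty, closed and convex). -/
def metricProj (D : Set V) (x : V) : V := Classical.epsilon (IsNearestPoint D x)

/-- The lattice-like operation `x ⊓ y = P_{x - K} y`. -/
def latticeMeet (K : Set V) (x y : V) : V := metricProj ({x} - K) y

/-- The lattice-like operation `x ⊔ y = P_{x + K} y`. -/
def latticeJoin (K : Set V) (x y : V) : V := metricProj ({x} + K) y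

/-- A lattice-like set: invariant with respect to the two lattice-like operations. -/
def IsLatticeLike (K M : Set V) : Prop :=
  ∀ x ∈ M, ∀ y ∈ M, latticeMeet K x y ∈ M ∧ latticeJoin K x y ∈ M

/-- The hyperplane through `0` with normal `a`. -/
def hyperplane (a : V) : Submodule ℝ V where
  carrier := {x | inner ℝ a x = 0}
  add_mem' {x y} hx hy := by
    simp only [Set.mem_ofPred_eq] at *
    rw [inner_add_right, hx, hy, add_zero]
  zero_mem' := inner_zero_right a
  smul_mem' t x hx := by
    simp only [Set.mem_ofPred_eq] at *
    rw [inner_smul_right, hx, mul_zero]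

end Lattice

end

open scoped InnerProductSpace

/-! In rank two every `x` satisfies `x * x = p • x + q • 1`. Completing the square yields a frame
with `x = l₀ c₀ + l₁ c₁`, and the trace form makes `c₀, c₁` orthonormal. So `⟪x, 1⟫ = l₀ + l₁` and
`‖x‖² = l₀² + l₁²`, whence both coefficients are nonnegative exactly when `‖x‖ ≤ ⟪x, 1⟫`: the cone
`Q` of squares is circular with axis `1` (`squareCone_eq_circularCone`).

By translation, `H` is lattice-like iff `P_Q` maps it into itself (`isLatticeLike_submodule_iff`).
If `a ⟂ 1`, the reflection in `H` preserves `Q`, hence `P_Q` preserves `H`. Conversely, simplicity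
gives a nonzero `w` orthogonal to a frame attached to `a`, hence to `a` and `1`; scaled to `‖w‖² =
2`, it projects to `(1 + w) / 2`, which forces `1 ∈ H`. Thus the condition is `a₁ + a₂ = 0`, and
`a₁² + a₂² = 1` fixes the coefficients up to sign.

For (2), products of trace-zero elements are scalar, so a hyperplane containing `1` is closed under
the product. -/

namespace EuclideanJordan

/-! ### Idempotents, spectral decomposition and trace -/

section Algebra

variable {V : Type*} [NormedAddCommGroup V] [InnerProductSpace ℝ V] [CommMagma V] [One V]
  [IsEuclideanJordanAlgebra V]

theorem one_mul (x : V) : 1 * x = x := IsEuclideanJordanAlgebra.one_mul' x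

theorem mul_one (x : V) : x * 1 = x := by rw [mul_comm, one_mul]

theorem add_mul (x y z : V) : (x + y) * z = x * z + y * z :=
  IsEuclideanJordanAlgebra.add_mul' x y z

theorem mul_add (x y z : V) : x * (y + z) = x * y + x * z := by
  rw [mul_comm, add_mul, mul_comm y, mul_comm z]

theorem smul_mul (t : ℝ) (x y : V) : (t • x) * y = t • (x * y) :=
  IsEuclideanJordanAlgebra.smul_mul' t x y

theorem mul_smul (t : ℝ) (x y : V) : x * (t • y) = t • (x * y) := by
  rw [mul_comm, smul_mul, mul_comm]

theorem zero_mul (x : V) : 0 * x = 0 := by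
  have h := smul_mul (0 : ℝ) x x
  rwa [zero_smul, zero_smul] at h

theorem inner_mul (x y z : V) : ⟪x * y, z⟫_ℝ = ⟪y, x * z⟫_ℝ :=
  IsEuclideanJordanAlgebra.inner_mul' x y z

theorem inner_mul_self_one (x : V) : ⟪x * x, 1⟫_ℝ = ‖x‖ ^ 2 := by
  rw [inner_mul, mul_one, real_inner_self_eq_norm_sq]

theorem one_ne_zero [Nontrivial V] : (1 : V) ≠ 0 := by
  intro h
  obtain ⟨x, hx⟩ := exists_ne (0 : V)
  exact hx (by rw [← one_mul x, h, zero_mul])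

theorem mul_eq_zero_of_add_idempotent {d f : V} (hd : d * d = d) (hf : f * f = f)
    (h : (d + f) * (d + f) = d + f) : d * f = 0 := by
  have h2 : (2 : ℝ) • (d * f) = 0 := by
    rw [add_mul, mul_add, mul_add, hd, hf, mul_comm f d] at h
    have h3 : (2 : ℝ) • (d * f) = (d + d * f + (d * f + f)) - (d + f) := by module
    rw [h3, h, sub_self]
  exact (smul_eq_zero.mp h2).resolve_left two_ne_zero

/-- A sum of two orthogonal idempotents acts as the unit on each of them. -/
theorem mul_one_sub_eq_zero {c c' d f : V} (hc : c + c' = 1) (h : c = d + f) (hd : d * d = d)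
    (hdf : d * f = 0) : d * c' = 0 := by
  have h1 : d * (c + c') = d := by rw [hc, mul_one]
  rw [h, mul_add, mul_add, hd, hdf, add_zero] at h1
  simpa using h1

/-- Every element satisfies a monic quadratic equation. -/
def IsQuadratic (V : Type*) [NormedAddCommGroup V] [InnerProductSpace ℝ V] [CommMagma V] [One V] :
    Prop := ∀ x : V, ∃ p q : ℝ, x * x = p • x + q • (1 : V)

/-- The element `d + 2f + 3g` has eigenvalues 1, 2, 3, and a monic quadratic cannot have three
roots. -/
theorem not_three_idempotents (hV : IsQuadratic V) {d f g : V}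
    (hd : d * d = d) (hf : f * f = f) (hg : g * g = g) (hdf : d * f = 0) (hdg : d * g = 0)
    (hfg : f * g = 0) (hsum : d + f + g = 1) (hd0 : d ≠ 0) (hf0 : f ≠ 0) (hg0 : g ≠ 0) :
    False := by
  have hfd : f * d = 0 := by rw [mul_comm, hdf]
  have hgd : g * d = 0 := by rw [mul_comm, hdg]
  have hgf : g * f = 0 := by rw [mul_comm, hfg]
  obtain ⟨p, q, h⟩ := hV (d + (2 : ℝ) • f + (3 : ℝ) • g)
  have key : (1 - p - q) • d + (4 - 2 * p - q) • f + (9 - 3 * p - q) • g = 0 := by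
    rw [← hsum] at h
    simp only [add_mul, mul_add, smul_mul, mul_smul, hd, hf, hg, hdf, hdg, hfg, hfd, hgd, hgf,
      smul_zero, add_zero, zero_add] at h
    rw [← sub_eq_zero] at h
    rw [← h]
    module
  have mulkey (u : V) : (1 - p - q) • (u * d) + (4 - 2 * p - q) • (u * f)
      + (9 - 3 * p - q) • (u * g) = 0 := by
    have := congrArg (u * ·) key
    simp only [mul_add, mul_smul] at this
    rw [this, mul_comm, zero_mul]
  have h1 := mulkey d
  have h2 := mulkey f
  have h3 := mulkey g
  simp only [hd, hf, hg, hdf, hdg, hfg, hfd, hgd, hgf, smul_zero, add_zero, zero_add,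
    smul_eq_zero, hd0, hf0, hg0, or_false] at h1 h2 h3
  linarith

/-- A splitting `c = d + f` would produce three orthogonal idempotents `d, f, c'` with sum 1. -/
theorem isPrimitiveIdempotent_of_add_eq_one (hV : IsQuadratic V) {c c' : V} (hc : c * c = c)
    (hc' : c' * c' = c') (hsum : c + c' = 1) (h0 : c ≠ 0) (h0' : c' ≠ 0) :
    IsPrimitiveIdempotent c := by
  refine ⟨h0, hc, fun d f hd hf hd0 hf0 h => ?_⟩
  have hdf : d * f = 0 := mul_eq_zero_of_add_idempotent hd hf (by rw [← h, hc])
  have hfd : f * d = 0 := by rw [mul_comm, hdf]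
  exact not_three_idempotents hV hd hf hc' hdf (mul_one_sub_eq_zero hsum h hd hdf)
    (mul_one_sub_eq_zero hsum (h.trans (add_comm d f)) hf hfd) (by rw [← h, hsum]) hd0 hf0 h0'

/-- The spectral decomposition of a nonscalar element. -/
theorem exists_frame_of_nonscalar [Nontrivial V] (hV : IsQuadratic V) {x : V}
    (hx : ∀ t : ℝ, x ≠ t • (1 : V)) :
    ∃ c : Fin 2 → V, IsJordanFrame c ∧ ∃ l : Fin 2 → ℝ, x = ∑ i, l i • c i := by
  obtain ⟨p, q, h⟩ := hV x
  -- Completing the square: `u` squares to the scalar `r`, and `r > 0` because `⟪u * u, 1⟫ = ‖u‖²`.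
  set u : V := x - (p / 2) • (1 : V) with hu
  set r : ℝ := q + p ^ 2 / 4 with hr
  have hxu : x = u + (p / 2) • (1 : V) := by rw [hu]; module
  have huu : u * u = r • (1 : V) := by
    have h1 : u = x + (-(p / 2)) • (1 : V) := by rw [hu]; module
    rw [h1]
    simp only [add_mul, mul_add, smul_mul, mul_smul, one_mul, mul_one, h]
    rw [hr]
    module
  have hu0 : u ≠ 0 := fun h0 => hx (p / 2) (by rw [hxu, h0, zero_add])
  have hr0 : 0 < r := by
    have h1 := inner_mul_self_one u
    rw [huu, inner_smul_left, real_inner_self_eq_norm_sq] at h1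
    have h2 : 0 < ‖u‖ ^ 2 := by positivity
    have h3 : 0 < ‖(1 : V)‖ ^ 2 := by have := one_ne_zero (V := V); positivity
    simp only [conj_trivial] at h1
    rw [← h1] at h2
    exact pos_of_mul_pos_left h2 h3.le
  set s : ℝ := √r with hs
  have hs0 : 0 < s := Real.sqrt_pos.mpr hr0
  have hss : s ^ 2 = r := Real.sq_sqrt hr0.le
  set v : V := s⁻¹ • u with hv
  have huv : u = s • v := by rw [hv, smul_smul, mul_inv_cancel₀ hs0.ne', one_smul]
  have hvv : v * v = 1 := by
    rw [hv, smul_mul, mul_smul, huu, smul_smul, smul_smul, ← hss]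
    have : s⁻¹ * s⁻¹ * s ^ 2 = 1 := by field_simp
    rw [this, one_smul]
  have hcc (t t' : ℝ) : ((1 / 2 : ℝ) • (1 : V) + t • v) * ((1 / 2 : ℝ) • (1 : V) + t' • v)
      = (1 / 4 + t * t') • (1 : V) + ((t + t') / 2) • v := by
    simp only [add_mul, mul_add, smul_mul, mul_smul, one_mul, mul_one, hvv]
    module
  -- Since `v * v = 1`, the elements `(1 ± v) / 2` are complementary idempotents.
  set c₀ : V := (1 / 2 : ℝ) • (1 : V) + (1 / 2 : ℝ) • v with hc₀
  set c₁ : V := (1 / 2 : ℝ) • (1 : V) + (-1 / 2 : ℝ) • v with hc₁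
  have h00 : c₀ * c₀ = c₀ := by rw [hcc]; module
  have h11 : c₁ * c₁ = c₁ := by rw [hcc]; module
  have h01 : c₀ * c₁ = 0 := by rw [hcc]; module
  have hsum : c₀ + c₁ = 1 := by rw [hc₀, hc₁]; module
  have hxc : x = (p / 2 + s) • c₀ + (p / 2 - s) • c₁ := by
    rw [hxu, huv, hc₀, hc₁]; module
  have h0 : c₀ ≠ 0 := fun h0 => hx (p / 2 - s) (by
    rw [h0, zero_add] at hsum
    rw [hxc, h0, hsum]; module)
  have h1 : c₁ ≠ 0 := fun h0 => hx (p / 2 + s) (by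
    rw [h0, add_zero] at hsum
    rw [hxc, h0, hsum]; module)
  refine ⟨![c₀, c₁], ⟨?_, ?_, by simpa using hsum⟩, ![p / 2 + s, p / 2 - s], by simpa using hxc⟩
  · rw [Fin.forall_fin_two]
    exact ⟨isPrimitiveIdempotent_of_add_eq_one hV h00 h11 hsum h0 h1,
      isPrimitiveIdempotent_of_add_eq_one hV h11 h00 ((add_comm c₁ c₀).trans hsum) h1 h0⟩
  · rw [Fin.forall_fin_two, Fin.forall_fin_two, Fin.forall_fin_two]
    simp [h01, mul_comm c₁ c₀]

theorem exists_frame [Nontrivial V] (hV : IsQuadratic V)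
    (hns : ∃ x : V, ∀ t : ℝ, x ≠ t • (1 : V)) (x : V) :
    ∃ c : Fin 2 → V, IsJordanFrame c ∧ ∃ l : Fin 2 → ℝ, x = ∑ i, l i • c i := by
  by_cases hx : ∃ t : ℝ, x = t • (1 : V)
  · obtain ⟨t, rfl⟩ := hx
    obtain ⟨y, hy⟩ := hns
    obtain ⟨c, hc, -⟩ := exists_frame_of_nonscalar hV hy
    exact ⟨c, hc, fun _ => t, by rw [← Finset.smul_sum, hc.2.2]⟩
  · exact exists_frame_of_nonscalar hV (by simpa using hx)

/-- The sum of the spectral coefficients depends on the element only. -/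
theorem spectral_sum_unique [Nontrivial V] {c d : Fin 2 → V} (hc : IsJordanFrame c)
    (hd : IsJordanFrame d) {l m : Fin 2 → ℝ} (h : ∑ i, l i • c i = ∑ i, m i • d i) :
    ∑ i, l i = ∑ i, m i := by
  -- Cayley–Hamilton: two decompositions with different sums give two quadratic equations whose
  -- difference makes the element scalar.
  have quad {c : Fin 2 → V} (hc : IsJordanFrame c) (l : Fin 2 → ℝ) :
      (∑ i, l i • c i) * (∑ i, l i • c i)
        = (l 0 + l 1) • (∑ i, l i • c i) - (l 0 * l 1) • (1 : V) := by
    rw [← hc.2.2]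
    simp only [Fin.sum_univ_two, add_mul, mul_add, smul_mul, mul_smul, (hc.1 0).2.1, (hc.1 1).2.1,
      hc.2.1 0 1 (by decide), hc.2.1 1 0 (by decide)]
    module
  have scalar {c : Fin 2 → V} (hc : IsJordanFrame c) {l : Fin 2 → ℝ} {t : ℝ}
      (h : ∑ i, l i • c i = t • (1 : V)) : l 0 + l 1 = 2 * t := by
    rw [← hc.2.2, Fin.sum_univ_two, Fin.sum_univ_two] at h
    have h0 := congrArg (c 0 * ·) h
    have h1 := congrArg (c 1 * ·) h
    simp only [mul_add, mul_smul, (hc.1 0).2.1, (hc.1 1).2.1,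
      hc.2.1 0 1 (by decide), hc.2.1 1 0 (by decide), smul_zero, add_zero, zero_add] at h0 h1
    have e0 := smul_left_injective ℝ (hc.1 0).1 h0
    have e1 := smul_left_injective ℝ (hc.1 1).1 h1
    linarith
  rw [Fin.sum_univ_two, Fin.sum_univ_two]
  by_cases hx : ∃ t : ℝ, ∑ i, l i • c i = t • (1 : V)
  · obtain ⟨t, ht⟩ := hx
    rw [scalar hc ht, scalar hd (h ▸ ht)]
  · have h1 := quad hc l
    have h2 := quad hd m
    rw [← h] at h2
    by_contra hne
    replace hne := sub_ne_zero.mpr hne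
    refine hx ⟨(l 0 + l 1 - (m 0 + m 1))⁻¹ * (l 0 * l 1 - m 0 * m 1), ?_⟩
    rw [← smul_smul, eq_inv_smul_iff₀ hne, sub_smul, sub_smul, sub_eq_sub_iff_sub_eq_sub,
      ← h1, ← h2]

theorem jordanTrace_eq [Nontrivial V] (hrank : jordanRank V = 2) {c : Fin 2 → V}
    (hc : IsJordanFrame c) (l : Fin 2 → ℝ) : jordanTrace (∑ i, l i • c i) = ∑ i, l i := by
  -- The rank occurs in the index type `Fin (jordanRank V)`; it is replaced by 2 before any frame is
  -- chosen.
  have hiff (x : V) (t : ℝ) : IsTraceOf x t ↔ ∃ (c : Fin 2 → V) (l : Fin 2 → ℝ),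
      IsJordanFrame c ∧ x = ∑ i, l i • c i ∧ t = ∑ i, l i := by
    unfold IsTraceOf
    rw [hrank]
  have h : IsTraceOf (∑ i, l i • c i) (jordanTrace (∑ i, l i • c i)) :=
    Classical.epsilon_spec (p := IsTraceOf (∑ i, l i • c i))
      ⟨∑ i, l i, (hiff _ _).mpr ⟨c, l, hc, rfl, rfl⟩⟩
  obtain ⟨d, m, hd, hm, ht⟩ := (hiff _ _).mp h
  rw [ht, spectral_sum_unique hc hd hm]

theorem inner_frame_one [Nontrivial V] (htrace : ∀ x y : V, ⟪x, y⟫_ℝ = jordanTrace (x * y))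
    (hrank : jordanRank V = 2) {c : Fin 2 → V} (hc : IsJordanFrame c) (i : Fin 2) :
    ⟪c i, 1⟫_ℝ = 1 := by
  have h := jordanTrace_eq hrank hc (Pi.single i 1)
  rw [htrace, mul_one]
  simpa [Pi.single_apply, ite_smul] using h

theorem inner_frame_frame {c : Fin 2 → V} (hc : IsJordanFrame c) : ⟪c 0, c 1⟫_ℝ = 0 := by
  rw [← mul_one (c 1), ← inner_mul, mul_comm, hc.2.1 0 1 (by decide), inner_zero_left]

theorem norm_sq_frame [Nontrivial V] (htrace : ∀ x y : V, ⟪x, y⟫_ℝ = jordanTrace (x * y))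
    (hrank : jordanRank V = 2) {c : Fin 2 → V} (hc : IsJordanFrame c) (i : Fin 2) :
    ‖c i‖ ^ 2 = 1 := by
  rw [← inner_mul_self_one, (hc.1 i).2.1, inner_frame_one htrace hrank hc]

end Algebra

/-! ### From rank two to quadratic equations -/

section Rank

theorem jordanPow_zero {V : Type*} [CommMagma V] [One V] (x : V) : jordanPow x 0 = 1 := rfl

theorem jordanPow_succ {V : Type*} [CommMagma V] [One V] (x : V) (n : ℕ) :
    jordanPow x (n + 1) = x * jordanPow x n := rfl

variable {V : Type*} [NormedAddCommGroup V] [InnerProductSpace ℝ V] [CommMagma V] [One V]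

theorem not_linearIndependent_of_rank [FiniteDimensional ℝ V] {n : ℕ} (hn : jordanRank V = n)
    (hn0 : n ≠ 0) (x : V) :
    ¬ LinearIndependent ℝ (fun i : Fin (n + 1) => jordanPow x i) := by
  -- An unbounded supremum in `ℕ` is 0 by convention, so a nonzero rank is a genuine maximum.
  have hbdd : BddAbove (Set.range fun x : V => jordanDegree x) := by
    by_contra h
    exact hn0 (hn.symm.trans (by rw [jordanRank, iSup, Nat.sSup_of_not_bddAbove h]))
  have hle : jordanDegree x ≤ n := hn ▸ le_ciSup hbdd x
  have hne : {k : ℕ | 0 < k ∧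
      ¬ LinearIndependent ℝ (fun i : Fin (k + 1) => jordanPow x i)}.Nonempty := by
    refine ⟨Module.finrank ℝ V + 1, Nat.succ_pos _, fun h => ?_⟩
    have := h.fintype_card_le_finrank
    rw [Fintype.card_fin] at this
    omega
  intro hli
  refine (Nat.sInf_mem hne).2 ?_
  exact hli.comp (Fin.castLE (Nat.succ_le_succ hle)) (Fin.castLE_injective _)

variable [IsEuclideanJordanAlgebra V]

theorem isQuadratic_of_rank_two [FiniteDimensional ℝ V] [Nontrivial V]
    (hrank : jordanRank V = 2) : IsQuadratic V := by
  intro x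
  have h := not_linearIndependent_of_rank hrank two_ne_zero x
  rw [Fintype.not_linearIndependent_iff] at h
  obtain ⟨g, hg, i, hi⟩ := h
  replace hg : g 0 • (1 : V) + g 1 • x + g 2 • (x * x) = 0 := by
    rw [← hg]
    refine Eq.trans ?_ (Fin.sum_univ_three _).symm
    change _ = g 0 • (1 : V) + g 1 • (x * 1) + g 2 • (x * (x * 1))
    rw [mul_one]
  by_cases h2 : g 2 = 0
  · by_cases h1 : g 1 = 0
    · rw [h1, h2, zero_smul, zero_smul, add_zero, add_zero] at hg
      have h0 := (smul_eq_zero.mp hg).resolve_right one_ne_zero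
      fin_cases i
      exacts [absurd h0 hi, absurd h1 hi, absurd h2 hi]
    -- Without a quadratic term `x` is itself a scalar `t • 1`, and then `x * x = t • x`.
    · refine ⟨-(g 0) / g 1, 0, ?_⟩
      have hx : x = (-(g 0) / g 1) • (1 : V) := by
        rw [div_eq_inv_mul, ← smul_smul, eq_inv_smul_iff₀ h1]
        rw [h2, zero_smul, add_zero] at hg
        rw [neg_smul, eq_neg_iff_add_eq_zero, add_comm, hg]
      nth_rewrite 1 [hx]
      rw [smul_mul, one_mul, zero_smul, add_zero]
  · refine ⟨(g 2)⁻¹ * -(g 1), (g 2)⁻¹ * -(g 0), ?_⟩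
    rw [← smul_smul, ← smul_smul, ← smul_add, eq_inv_smul_iff₀ h2]
    rw [← sub_eq_zero, ← hg]
    module

theorem exists_nonscalar_of_rank_two (hrank : jordanRank V = 2) :
    ∃ x : V, ∀ t : ℝ, x ≠ t • (1 : V) := by
  by_contra! h
  have hle : jordanRank V ≤ 1 := by
    refine ciSup_le' fun x => Nat.sInf_le ⟨one_pos, fun hli => ?_⟩
    obtain ⟨t, ht⟩ := h x
    rw [Fintype.linearIndependent_iff] at hli
    have := hli ![-t, 1] (by
      simp [Fin.sum_univ_two, jordanPow_zero, jordanPow_succ, mul_one, ← ht]) 1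
    simp at this
  omega

end Rank

/-! ### Metric projection and the circular cone -/

section Cone

/-- Isometries transport nearest points. -/
theorem isNearestPoint_image {V : Type*} [NormedAddCommGroup V] {D E : Set V} (f : V ≃ᵢ V) (hf : f '' D = E) {x p : V}
    (h : IsNearestPoint D x p) : IsNearestPoint E (f x) (f p) := by
  subst hf
  refine ⟨Set.mem_image_of_mem _ h.1, ?_⟩
  rw [← dist_eq_norm, f.dist_eq, dist_eq_norm, h.2]
  refine (f.toEquiv.image D).iInf_congr fun y => ?_
  rw [← dist_eq_norm, ← dist_eq_norm]
  exact f.dist_eq x y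

variable {V : Type*} [NormedAddCommGroup V] [InnerProductSpace ℝ V]

/-- The circular cone with axis `e`. -/
def circularCone (e : V) : Set V := {x | ‖x‖ ≤ ⟪x, e⟫_ℝ}

theorem isClosed_circularCone (e : V) : IsClosed (circularCone e) :=
  isClosed_le (by fun_prop) (by fun_prop)

theorem convex_circularCone (e : V) : Convex ℝ (circularCone e) := by
  intro x hx y hy s t hs ht _
  change ‖s • x + t • y‖ ≤ ⟪s • x + t • y, e⟫_ℝ
  refine (norm_add_le _ _).trans ?_
  rw [inner_add_left, real_inner_smul_left, real_inner_smul_left, norm_smul, norm_smul,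
    Real.norm_of_nonneg hs, Real.norm_of_nonneg ht]
  exact add_le_add (mul_le_mul_of_nonneg_left hx hs) (mul_le_mul_of_nonneg_left hy ht)

theorem zero_mem_circularCone (e : V) : (0 : V) ∈ circularCone e := by
  simp [circularCone]

/-- Adding the variational inequalities at `p` and at `q` gives `‖q - p‖² ≤ 0`. -/
theorem isNearestPoint_unique {D : Set V} (hD : Convex ℝ D) {x p q : V}
    (hp : IsNearestPoint D x p) (hq : IsNearestPoint D x q) : p = q := by
  have h1 := (norm_eq_iInf_iff_real_inner_le_zero hD hp.1).mp hp.2 q hq.1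
  have h2 := (norm_eq_iInf_iff_real_inner_le_zero hD hq.1).mp hq.2 p hp.1
  have h3 : ⟪q - p, q - p⟫_ℝ = ⟪x - p, q - p⟫_ℝ + ⟪x - q, p - q⟫_ℝ := by
    rw [← neg_sub q p, inner_neg_right, ← sub_eq_add_neg, ← inner_sub_left]
    congr 1
    abel
  have h4 : ⟪q - p, q - p⟫_ℝ ≤ 0 := by linarith
  exact (sub_eq_zero.mp (inner_self_eq_zero (𝕜 := ℝ).mp (le_antisymm h4 real_inner_self_nonneg))).symm

theorem metricProj_eq {D : Set V} (hD : Convex ℝ D) {x p : V} (hp : IsNearestPoint D x p) :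
    metricProj D x = p :=
  isNearestPoint_unique hD (Classical.epsilon_spec (p := IsNearestPoint D x) ⟨p, hp⟩) hp

/-- The isometry `u ↦ x - u` carries `K` to `x - K` and `x - y` to `y`. -/
theorem latticeMeet_eq {K : Set V} (hK : Convex ℝ K) {x y p : V}
    (hp : IsNearestPoint K (x - y) p) : latticeMeet K x y = x - p := by
  refine metricProj_eq ((convex_singleton x).sub hK) ?_
  have h := isNearestPoint_image (E := {x} - K) (IsometryEquiv.subLeft x) (by
    rw [Set.singleton_sub]; rfl) hp
  simpa using h

theorem latticeJoin_eq {K : Set V} (hK : Convex ℝ K) {x y p : V}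
    (hp : IsNearestPoint K (y - x) p) : latticeJoin K x y = x + p := by
  refine metricProj_eq ((convex_singleton x).add hK) ?_
  have h := isNearestPoint_image (E := {x} + K) (IsometryEquiv.addLeft x) (by
    rw [Set.singleton_add]; rfl) hp
  simpa using h

/-- A subspace is lattice-like iff it is invariant under the projection onto the cone. -/
theorem isLatticeLike_submodule_iff [CompleteSpace V] {K : Set V} (hne : K.Nonempty)
    (hcl : IsClosed K) (hK : Convex ℝ K) (S : Submodule ℝ V) :
    IsLatticeLike K (S : Set V) ↔ ∀ z ∈ S, ∀ p, IsNearestPoint K z p → p ∈ S := by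
  constructor
  · intro h z hz p hp
    have := (h 0 S.zero_mem z hz).2
    rwa [latticeJoin_eq hK (p := p) (by rwa [sub_zero]), zero_add] at this
  · intro h x hx y hy
    have ex (z : V) : ∃ p, IsNearestPoint K z p :=
      exists_norm_eq_iInf_of_complete_convex hne hcl.isComplete hK z
    obtain ⟨p, hp⟩ := ex (x - y)
    obtain ⟨q, hq⟩ := ex (y - x)
    rw [latticeMeet_eq hK hp, latticeJoin_eq hK hq]
    exact ⟨S.sub_mem hx (h _ (S.sub_mem hx hy) p hp), S.add_mem hx (h _ (S.sub_mem hy hx) q hq)⟩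

theorem mem_hyperplane {a x : V} : x ∈ hyperplane a ↔ ⟪a, x⟫_ℝ = 0 := Iff.rfl

theorem hyperplane_eq_orthogonal (a : V) : hyperplane a = (ℝ ∙ a)ᗮ := by
  ext x
  rw [mem_hyperplane, Submodule.mem_orthogonal_singleton_iff_inner_right]

/-- The reflection in a hyperplane containing the axis preserves the circular cone, so it fixes the
projections of the points of the hyperplane. -/
theorem nearestPoint_mem_hyperplane {e a z p : V} (ha : ⟪a, e⟫_ℝ = 0) (hz : z ∈ hyperplane a)
    (hp : IsNearestPoint (circularCone e) z p) : p ∈ hyperplane a := by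
  rw [hyperplane_eq_orthogonal] at hz ⊢
  set ρ : V ≃ₗᵢ[ℝ] V := (ℝ ∙ a)ᗮ.reflection with hρ
  have he : ρ e = e := by
    rw [hρ, Submodule.reflection_eq_self_iff, Submodule.mem_orthogonal_singleton_iff_inner_right]
    exact ha
  have hz' : ρ z = z := (Submodule.reflection_eq_self_iff z).mpr hz
  have hmem (x : V) (hx : x ∈ circularCone e) : ρ x ∈ circularCone e := by
    change ‖ρ x‖ ≤ ⟪ρ x, e⟫_ℝ
    rw [← he, ρ.inner_map_map, ρ.norm_map]
    exact hx
  have himage : ρ.toIsometryEquiv '' circularCone e = circularCone e := by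
    refine Set.Subset.antisymm (Set.image_subset_iff.mpr hmem) fun x hx => ⟨ρ x, hmem x hx, ?_⟩
    exact Submodule.reflection_reflection _ x
  have h := isNearestPoint_image ρ.toIsometryEquiv himage hp
  have h' : IsNearestPoint (circularCone e) z (ρ p) := by
    have hzz : ρ.toIsometryEquiv z = z := hz'
    rwa [hzz] at h
  exact (Submodule.reflection_eq_self_iff p).mp
    (isNearestPoint_unique (convex_circularCone e) h' hp)

/-- The projection onto the circular cone of a vector orthogonal to the axis. -/
theorem isNearestPoint_circularCone {e w : V} (he : ‖e‖ ^ 2 = 2) (hw : ‖w‖ ^ 2 = 2)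
    (hwe : ⟪w, e⟫_ℝ = 0) :
    IsNearestPoint (circularCone e) w ((1 / 2 : ℝ) • (e + w)) := by
  have hee : ⟪e, e⟫_ℝ = 2 := by rw [real_inner_self_eq_norm_sq, he]
  have hww : ⟪w, w⟫_ℝ = 2 := by rw [real_inner_self_eq_norm_sq, hw]
  have hew : ⟪e, w⟫_ℝ = 0 := by rw [real_inner_comm, hwe]
  have hmem : (1 / 2 : ℝ) • (e + w) ∈ circularCone e := by
    change ‖(1 / 2 : ℝ) • (e + w)‖ ≤ ⟪(1 / 2 : ℝ) • (e + w), e⟫_ℝ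
    rw [real_inner_smul_left, inner_add_left, hee, hwe]
    refine abs_le_of_sq_le_sq' ?_ (by norm_num) |>.2
    rw [← real_inner_self_eq_norm_sq, real_inner_smul_left, real_inner_smul_right,
      inner_add_left, inner_add_right, inner_add_right, hee, hww, hew, hwe]
    norm_num
  refine ⟨hmem, (norm_eq_iInf_iff_real_inner_le_zero (convex_circularCone e) hmem).mpr
    fun q hq => ?_⟩
  have hq' : ‖q‖ ≤ ⟪q, e⟫_ℝ := hq
  have hq0 : 0 ≤ ⟪q, e⟫_ℝ := (norm_nonneg q).trans hq'
  -- The residual `(w - e) / 2` is orthogonal to `(e + w) / 2`, so this bound is all that optimality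
  -- needs. It is Cauchy–Schwarz for `w` and the part `v` of `q` orthogonal to `e`.
  have hdual : ⟪q, w⟫_ℝ ≤ ⟪q, e⟫_ℝ := by
    set v : V := q - (⟪q, e⟫_ℝ / 2) • e with hv
    have h1 : ⟪v, w⟫_ℝ = ⟪q, w⟫_ℝ := by
      rw [hv, inner_sub_left, real_inner_smul_left, hew, mul_zero, sub_zero]
    have h2 : ‖v‖ ^ 2 = ‖q‖ ^ 2 - ⟪q, e⟫_ℝ ^ 2 / 2 := by
      rw [hv, norm_sub_sq_real, real_inner_smul_right, norm_smul, mul_pow, he,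
        Real.norm_eq_abs, sq_abs]
      ring
    have h3 : ‖q‖ ^ 2 ≤ ⟪q, e⟫_ℝ ^ 2 := pow_le_pow_left₀ (norm_nonneg q) hq' 2
    rw [← h1]
    refine (real_inner_le_norm v w).trans (abs_le_of_sq_le_sq' ?_ hq0 |>.2)
    rw [mul_pow, hw, h2]
    linarith
  have h1 : w - (1 / 2 : ℝ) • (e + w) = (1 / 2 : ℝ) • (w - e) := by module
  rw [h1, real_inner_smul_left, inner_sub_right, inner_sub_left, inner_sub_left,
    real_inner_smul_right, real_inner_smul_right, inner_add_right, inner_add_right,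
    hee, hww, hew, hwe, real_inner_comm, real_inner_comm q e]
  linarith

end Cone

/-! ### Geometry of rank-two algebras and lattice-like hyperplanes -/

section RankTwo

variable {V : Type*} [NormedAddCommGroup V] [InnerProductSpace ℝ V] [CommMagma V] [One V]
  [IsEuclideanJordanAlgebra V]

theorem norm_sq_sum_frame [Nontrivial V] (htrace : ∀ x y : V, ⟪x, y⟫_ℝ = jordanTrace (x * y))
    (hrank : jordanRank V = 2) {c : Fin 2 → V} (hc : IsJordanFrame c) (s t : ℝ) :
    ‖s • c 0 + t • c 1‖ ^ 2 = s ^ 2 + t ^ 2 := by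
  rw [norm_add_sq_real, real_inner_smul_left, real_inner_smul_right, inner_frame_frame hc,
    norm_smul, norm_smul, mul_pow, mul_pow, norm_sq_frame htrace hrank hc,
    norm_sq_frame htrace hrank hc, Real.norm_eq_abs, Real.norm_eq_abs, sq_abs, sq_abs]
  ring

theorem inner_sum_frame_one [Nontrivial V] (htrace : ∀ x y : V, ⟪x, y⟫_ℝ = jordanTrace (x * y))
    (hrank : jordanRank V = 2) {c : Fin 2 → V} (hc : IsJordanFrame c) (s t : ℝ) :
    ⟪s • c 0 + t • c 1, 1⟫_ℝ = s + t := by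
  rw [inner_add_left, real_inner_smul_left, real_inner_smul_left,
    inner_frame_one htrace hrank hc, inner_frame_one htrace hrank hc]
  ring

/-- In an algebra of rank two the square of a vector orthogonal to the unit is scalar. -/
theorem mul_self_of_inner_one_eq_zero [FiniteDimensional ℝ V] [Nontrivial V]
    (htrace : ∀ x y : V, ⟪x, y⟫_ℝ = jordanTrace (x * y))
    (hrank : jordanRank V = 2) {w : V} (hw : ⟪w, 1⟫_ℝ = 0) :
    w * w = (‖w‖ ^ 2 / 2) • (1 : V) := by
  obtain ⟨c, hc, l, rfl⟩ := exists_frame (isQuadratic_of_rank_two hrank)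
    (exists_nonscalar_of_rank_two hrank) w
  have hl : l 1 = -l 0 := by
    rw [Fin.sum_univ_two, inner_add_left, real_inner_smul_left, real_inner_smul_left,
      inner_frame_one htrace hrank hc, inner_frame_one htrace hrank hc] at hw
    linarith
  rw [← hc.2.2, Fin.sum_univ_two, norm_sq_sum_frame htrace hrank hc]
  simp only [Fin.sum_univ_two, add_mul, mul_add, smul_mul, mul_smul, (hc.1 0).2.1, (hc.1 1).2.1,
    hc.2.1 0 1 (by decide), hc.2.1 1 0 (by decide), hl]
  module

theorem norm_one_sq [Nontrivial V] (htrace : ∀ x y : V, ⟪x, y⟫_ℝ = jordanTrace (x * y))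
    (hrank : jordanRank V = 2) {c : Fin 2 → V} (hc : IsJordanFrame c) : ‖(1 : V)‖ ^ 2 = 2 := by
  rw [← real_inner_self_eq_norm_sq]
  nth_rewrite 1 [← hc.2.2]
  rw [Fin.sum_univ_two, inner_add_left, inner_frame_one htrace hrank hc,
    inner_frame_one htrace hrank hc]
  norm_num

/-- Polarization of `mul_self_of_inner_one_eq_zero`. -/
theorem mul_of_inner_one_eq_zero [FiniteDimensional ℝ V] [Nontrivial V]
    (htrace : ∀ x y : V, ⟪x, y⟫_ℝ = jordanTrace (x * y))
    (hrank : jordanRank V = 2) {w z : V} (hw : ⟪w, 1⟫_ℝ = 0) (hz : ⟪z, 1⟫_ℝ = 0) :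
    w * z = (⟪w, z⟫_ℝ / 2) • (1 : V) := by
  have h := mul_self_of_inner_one_eq_zero htrace hrank (w := w + z)
    (by rw [inner_add_left, hw, hz, add_zero])
  rw [norm_add_sq_real, add_mul, mul_add, mul_add, mul_comm z w,
    mul_self_of_inner_one_eq_zero htrace hrank hw,
    mul_self_of_inner_one_eq_zero htrace hrank hz] at h
  have h2 : (2 : ℝ) • (w * z) = (2 : ℝ) • ((⟪w, z⟫_ℝ / 2) • (1 : V)) := by
    rw [← sub_eq_zero] at h ⊢
    rw [← h]
    module
  exact smul_right_injective V (two_ne_zero (α := ℝ)) h2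

/-- A nonnegative combination of orthogonal idempotents is a square. -/
theorem smul_frame_mem_squareCone {c : Fin 2 → V} (hc : IsJordanFrame c) {l : Fin 2 → ℝ}
    (hl : ∀ i, 0 ≤ l i) : ∑ i, l i • c i ∈ squareCone V := by
  refine ⟨∑ i, √(l i) • c i, ?_⟩
  simp only [Fin.sum_univ_two, add_mul, mul_add, smul_mul, mul_smul, (hc.1 0).2.1, (hc.1 1).2.1,
    hc.2.1 0 1 (by decide), hc.2.1 1 0 (by decide), smul_zero, add_zero, zero_add, smul_smul,
    Real.mul_self_sqrt (hl _)]

/-- In rank two the cone of squares is circular. -/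
theorem squareCone_eq_circularCone [FiniteDimensional ℝ V] [Nontrivial V]
    (htrace : ∀ x y : V, ⟪x, y⟫_ℝ = jordanTrace (x * y)) (hrank : jordanRank V = 2) :
    squareCone V = circularCone (1 : V) := by
  have spec := exists_frame (isQuadratic_of_rank_two hrank) (exists_nonscalar_of_rank_two hrank)
  ext x
  constructor
  · rintro ⟨y, rfl⟩
    obtain ⟨c, hc, l, rfl⟩ := spec y
    have h : (∑ i, l i • c i) * (∑ i, l i • c i) = (l 0 ^ 2) • c 0 + (l 1 ^ 2) • c 1 := by
      simp only [Fin.sum_univ_two, add_mul, mul_add, smul_mul, mul_smul, (hc.1 0).2.1,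
        (hc.1 1).2.1, hc.2.1 0 1 (by decide), hc.2.1 1 0 (by decide)]
      module
    rw [h]
    change ‖_‖ ≤ ⟪_, _⟫_ℝ
    rw [inner_sum_frame_one htrace hrank hc]
    refine abs_le_of_sq_le_sq' ?_ (by positivity) |>.2
    rw [norm_sq_sum_frame htrace hrank hc]
    nlinarith [mul_nonneg (sq_nonneg (l 0)) (sq_nonneg (l 1))]
  · intro hx
    obtain ⟨c, hc, l, rfl⟩ := spec x
    refine smul_frame_mem_squareCone hc ?_
    change ‖_‖ ≤ ⟪_, _⟫_ℝ at hx
    have h2 := pow_le_pow_left₀ (norm_nonneg _) hx 2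
    have h0 := (norm_nonneg _).trans hx
    rw [Fin.sum_univ_two] at h0 h2
    rw [inner_sum_frame_one htrace hrank hc] at h0 h2
    rw [norm_sq_sum_frame htrace hrank hc] at h2
    -- Here `l₀² + l₁² ≤ (l₀ + l₁)²` says `l₀ l₁ ≥ 0`; as the sum is nonnegative too, neither
    -- coefficient is negative.
    rw [Fin.forall_fin_two]
    constructor <;> nlinarith

/-- Simplicity provides a nonzero vector orthogonal to a given Jordan frame. -/
theorem exists_ne_zero_orthogonal_frame [FiniteDimensional ℝ V] (hsimple : IsSimpleJordan V)
    {c : Fin 2 → V} (hc : IsJordanFrame c) :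
    ∃ w : V, w ≠ 0 ∧ ⟪c 0, w⟫_ℝ = 0 ∧ ⟪c 1, w⟫_ℝ = 0 := by
  -- If the frame spanned `V`, the line through `c 0` would be a nontrivial ideal.
  have htop : Submodule.span ℝ {c 0, c 1} ≠ ⊤ := by
    intro htop
    have hideal : IsJordanIdeal (ℝ ∙ c 0) := by
      intro x y hy
      obtain ⟨r, s, rfl⟩ := Submodule.mem_span_pair.mp (htop ▸ Submodule.mem_top : x ∈ _)
      obtain ⟨t, rfl⟩ := Submodule.mem_span_singleton.mp hy
      simp only [add_mul, smul_mul, mul_smul, (hc.1 0).2.1, hc.2.1 1 0 (by decide), smul_zero,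
        add_zero]
      exact Submodule.smul_mem _ _ (Submodule.smul_mem _ _ (Submodule.mem_span_singleton_self _))
    rcases hsimple.2 _ hideal with h | h
    · exact (hc.1 0).1 (Submodule.span_singleton_eq_bot.mp h)
    · obtain ⟨t, ht⟩ := Submodule.mem_span_singleton.mp (h ▸ Submodule.mem_top : c 1 ∈ ℝ ∙ c 0)
      refine (hc.1 1).1 ?_
      rw [← (hc.1 1).2.1]
      nth_rewrite 2 [← ht]
      rw [mul_smul, hc.2.1 1 0 (by decide), smul_zero]
  have hbot : (Submodule.span ℝ {c 0, c 1})ᗮ ≠ ⊥ := by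
    rwa [Ne, Submodule.orthogonal_eq_bot_iff]
  obtain ⟨w, hw, hw0⟩ := Submodule.exists_mem_ne_zero_of_ne_bot hbot
  exact ⟨w, hw0, hw _ (Submodule.subset_span (by simp)), hw _ (Submodule.subset_span (by simp))⟩

/-- In rank two a hyperplane is lattice-like iff it contains the unit. -/
theorem isLatticeLike_hyperplane_iff [FiniteDimensional ℝ V]
    (htrace : ∀ x y : V, ⟪x, y⟫_ℝ = jordanTrace (x * y)) (hsimple : IsSimpleJordan V)
    (hrank : jordanRank V = 2) (a : V) :
    IsLatticeLike (squareCone V) (hyperplane a : Set V) ↔ ⟪a, 1⟫_ℝ = 0 := by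
  have := hsimple.1
  have : CompleteSpace V := FiniteDimensional.complete ℝ V
  rw [squareCone_eq_circularCone htrace hrank,
    isLatticeLike_submodule_iff ⟨0, zero_mem_circularCone _⟩ (isClosed_circularCone _)
      (convex_circularCone _)]
  refine ⟨fun h => ?_, fun ha z hz p hp => nearestPoint_mem_hyperplane ha hz hp⟩
  obtain ⟨c, hc, l, rfl⟩ := exists_frame (isQuadratic_of_rank_two hrank)
    (exists_nonscalar_of_rank_two hrank) a
  obtain ⟨w, hw0, h0, h1⟩ := exists_ne_zero_orthogonal_frame hsimple hc
  -- Scaled to the norm of `1`, which puts the projection of `v` at `(1 + v) / 2`.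
  set v : V := (√2 * ‖w‖⁻¹) • w with hv
  have hvn : ‖v‖ ^ 2 = 2 := by
    have : ‖w‖ ≠ 0 := norm_ne_zero_iff.mpr hw0
    rw [hv, norm_smul, mul_pow, Real.norm_eq_abs, sq_abs, mul_pow, Real.sq_sqrt (by norm_num)]
    field_simp
  have hv0 : ⟪c 0, v⟫_ℝ = 0 := by rw [hv, real_inner_smul_right, h0, mul_zero]
  have hv1 : ⟪c 1, v⟫_ℝ = 0 := by rw [hv, real_inner_smul_right, h1, mul_zero]
  have hve : ⟪v, 1⟫_ℝ = 0 := by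
    rw [real_inner_comm, ← hc.2.2, Fin.sum_univ_two, inner_add_left, hv0, hv1, add_zero]
  have hva : ⟪∑ i, l i • c i, v⟫_ℝ = 0 := by
    rw [Fin.sum_univ_two, inner_add_left, real_inner_smul_left, real_inner_smul_left, hv0, hv1]
    ring
  have hp := h v hva _ (isNearestPoint_circularCone (norm_one_sq htrace hrank hc) hvn hve)
  rw [mem_hyperplane, real_inner_smul_right, inner_add_right, hva] at hp
  linarith

/-- Subtracting multiples of `1` makes both factors trace-zero; their product is then scalar, hence
orthogonal to `a`, and the correction terms lie in the hyperplane. -/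
theorem isJordanSubalgebra_hyperplane [FiniteDimensional ℝ V] [Nontrivial V]
    (htrace : ∀ x y : V, ⟪x, y⟫_ℝ = jordanTrace (x * y)) (hrank : jordanRank V = 2) {a : V}
    (ha : ⟪a, 1⟫_ℝ = 0) : IsJordanSubalgebra (hyperplane a) := by
  intro x hx y hy
  obtain ⟨c, hc, -⟩ := exists_frame (isQuadratic_of_rank_two hrank)
    (exists_nonscalar_of_rank_two hrank) a
  have hone : ⟪(1 : V), 1⟫_ℝ = 2 := by
    rw [real_inner_self_eq_norm_sq, norm_one_sq htrace hrank hc]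
  rw [mem_hyperplane] at hx hy ⊢
  have perp (z : V) : ⟪z + (-(⟪z, 1⟫_ℝ / 2)) • (1 : V), 1⟫_ℝ = 0 := by
    rw [inner_add_left, real_inner_smul_left, hone]
    ring
  have h := congrArg (fun v => ⟪a, v⟫_ℝ) (mul_of_inner_one_eq_zero htrace hrank (perp x) (perp y))
  simpa only [add_mul, mul_add, smul_mul, mul_smul, one_mul, mul_one, inner_add_right,
    real_inner_smul_right, ha, hx, hy, mul_zero, add_zero] using h

end RankTwo

end EuclideanJordan

open EuclideanJordan in
theorem mainTheorem4 {V : Type*} [NormedAddCommGroup V] [InnerProductSpace ℝ V]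
    [FiniteDimensional ℝ V] [CommMagma V] [One V] [IsEuclideanJordanAlgebra V]
    (htrace : ∀ x y : V, inner ℝ x y = jordanTrace (x * y))
    (hsimple : IsSimpleJordan V) (hrank : jordanRank V = 2)
    (a : V) (ha : ‖a‖ = 1) :
    -- `H` is lattice-like iff `a = √2/2 c₁ - √2/2 c₂` for some Jordan frame `c₁, c₂`
    (IsLatticeLike (squareCone V) (hyperplane a : Set V) ↔
      ∃ c : Fin 2 → V, IsJordanFrame c ∧
        a = (Real.sqrt 2 / 2) • c 0 - (Real.sqrt 2 / 2) • c 1) ∧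
    -- the same, read in any given Jordan frame attached to `a`, up to the order of `c₁, c₂`
    (∀ c : Fin 2 → V, IsJordanFrame c → ∀ a₁ a₂ : ℝ, a = a₁ • c 0 + a₂ • c 1 →
      (IsLatticeLike (squareCone V) (hyperplane a : Set V) ↔
        (a₁ = Real.sqrt 2 / 2 ∧ a₂ = -(Real.sqrt 2 / 2)) ∨
        (a₁ = -(Real.sqrt 2 / 2) ∧ a₂ = Real.sqrt 2 / 2))) ∧
    -- in this case `H` is a Jordan subalgebra
    (IsLatticeLike (squareCone V) (hyperplane a : Set V) →
      IsJordanSubalgebra (hyperplane a)) := by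
  have := hsimple.1
  have hiff := isLatticeLike_hyperplane_iff htrace hsimple hrank a
  have h2 : √2 ^ 2 = 2 := Real.sq_sqrt (by norm_num)
  have coords (c : Fin 2 → V) (hc : IsJordanFrame c) (a₁ a₂ : ℝ) (hac : a = a₁ • c 0 + a₂ • c 1) :
      IsLatticeLike (squareCone V) (hyperplane a : Set V) ↔
        (a₁ = √2 / 2 ∧ a₂ = -(√2 / 2)) ∨ (a₁ = -(√2 / 2) ∧ a₂ = √2 / 2) := by
    have hn : a₁ ^ 2 + a₂ ^ 2 = 1 := by
      rw [← norm_sq_sum_frame htrace hrank hc, ← hac, ha, one_pow]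
    rw [hiff, hac, inner_sum_frame_one htrace hrank hc]
    constructor
    · intro h
      obtain rfl : a₂ = -a₁ := by linarith
      have h3 : a₁ ^ 2 = (√2 / 2) ^ 2 := by linarith
      rcases sq_eq_sq_iff_eq_or_eq_neg.mp h3 with h4 | h4
      · exact Or.inl ⟨h4, by rw [h4]⟩
      · exact Or.inr ⟨h4, by rw [h4, neg_neg]⟩
    · rintro (⟨rfl, rfl⟩ | ⟨rfl, rfl⟩) <;> ring
  refine ⟨⟨fun h => ?_, fun ⟨c, hc, hac⟩ => ?_⟩, coords,
    fun h => isJordanSubalgebra_hyperplane htrace hrank (hiff.mp h)⟩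
  · obtain ⟨c, hc, l, hl⟩ := exists_frame (isQuadratic_of_rank_two hrank)
      (exists_nonscalar_of_rank_two hrank) a
    rw [Fin.sum_univ_two] at hl
    rcases (coords c hc _ _ hl).mp h with ⟨h0, h1⟩ | ⟨h0, h1⟩
    · exact ⟨c, hc, by rw [hl, h0, h1]; module⟩
    -- The opposite sign pattern is absorbed by swapping the frame.
    · refine ⟨![c 1, c 0], ⟨?_, ?_, ?_⟩, ?_⟩
      · rw [Fin.forall_fin_two]
        exact ⟨hc.1 1, hc.1 0⟩
      · rw [Fin.forall_fin_two, Fin.forall_fin_two, Fin.forall_fin_two]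
        simp [hc.2.1 0 1 (by decide), hc.2.1 1 0 (by decide)]
      · rw [← hc.2.2, Fin.sum_univ_two, Fin.sum_univ_two]
        exact add_comm _ _
      · rw [hl, h0, h1]
        simp only [Matrix.cons_val_zero, Matrix.cons_val_one]
        module
  · exact (coords c hc (√2 / 2) (-(√2 / 2)) (by rw [hac]; module)).mpr (Or.inl ⟨rfl, rfl⟩)
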